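/- Let $d\ge 2$ and let $\Lambda=\prod_{i=1}^d (a_i,b_i]\subset\mathbb{R}^d$, $a_i<b_i$, be a rectangular box with periodic boundary conditions: differences $x-y$ of points of $\Lambda$ are understood modulo $\Lambda$, so that $|x-y|=\min_{m\in\mathbb{Z}^d}\|x-y+(m_i(b_i-a_i))_{i}\|$ with the Euclidean norm $\|\cdot\|$. Let $\mathcal{X}_\Lambda$ be the set of all finite subsets of $\Lambda$. For $X\in\mathcal{X}_\Lambda$ let $E_X=\{\{x,y\}\subset X: x\ne y,\ |x-y|\le 1\}$; the connected components of the graph $(X,E_X)$ are called the clusters of $X$, and $k(X)$ is their number. Let $\kappa(\Lambda)=\max\{k(X): X\in\mathcal{X}_\Lambda\}$; this maximum exists. Let $L_\Lambda$ be the Lebesgue--Poisson measure on $\mathcal{X}_\Lambda$, \[ L_\Lambda(A)=\sum_{n\ge 0}\frac1{n!}\int_{\Lambda^n}1_A(\{x_1,\dots,x_n\})\,dx_1\cdots dx_n , \] and, for $q>0$ and $z>0$, let $\chi_{\Lambda,z,0}$ be the Widom--Rowlinson (temperature $T=0$) random-cluster measure, i.e. the probability measure \[ \chi_{\Lambda,z,0}(dX)=Z_{\Lambda,z,0}^{-1}\,z^{\#X}q^{k(X)}\,L_\Lambda(dX),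 \] where $Z_{\Lambda,z,0}\in(0,\infty)$ is the normalizing constant. For $X\in\mathcal{X}_\Lambda$ and a cluster $C$ of $X$ let $\Delta_C(X)=\{x\in\Lambda: |y-x|>1 \text{ for all } y\in X\setminus C\}$, and define the dissociation probability of $C$ by \[ \delta_C(X)=|\Delta_C(X)|^{-\#C}\int_{\Delta_C(X)^{\#C}}1_{\{k(\{x_1,\dots,x_{\#C}\})\ge 2\}}\,dx_1\cdots dx_{\#C}, \] where $|\cdot|$ of a set is its Lebesgue measure; this is the probability that $\#C$ points thrown independently and uniformly into $\Delta_C(X)$ form at least two clusters. Then for all $q>0$, $\delta>0$ and $z>0$, \[ \chi_{\Lambda,z,0}\big(X\in\mathcal{X}_\Lambda:\ \exists\text{ a cluster } C\subset X \text{ with } \delta_C(X)\ge\delta\big)\ \le\ \frac{2^{\kappa(\Lambda)}}{\delta q}. \] -/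

import Mathlib

open MeasureTheory

noncomputable section

namespace ContinuumPotts

/-- Points of `ℝ^d`, with the Euclidean norm and Lebesgue measure. -/
abbrev Point (d : ℕ) : Type := EuclideanSpace ℝ (Fin d)

/-- Configurations: finite subsets of `ℝ^d`; the configurations in a box are those contained in
the box. This is a one-field structure, and not `Finset (Point d)` itself, because the general
σ-algebra on `Finset α` (generated by the maps `a ∈ ·`) does not see the Borel structure
of `ℝ^d`. -/
@[ext]
structure Config (d : ℕ) : Type where
  /-- The set of occupied positions. -/
  points : Finset (Point d)

/-- The configuration `{x₁, …, xₙ}`. -/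
def toConfig {d : ℕ} (n : ℕ) (x : Fin n → Point d) : Config d :=
  open Classical in ⟨Finset.univ.image x⟩

/-- A set `A` of finite configurations is measurable if, for every `n`, the set of all
`(x₁, …, xₙ)` with `{x₁, …, xₙ} ∈ A` is a Borel set. -/
instance configMeasurableSpace (d : ℕ) : MeasurableSpace (Config d) :=
  ⨅ n : ℕ, MeasurableSpace.map (toConfig (d := d) n) inferInstance

theorem measurable_toConfig {d : ℕ} (n : ℕ) : Measurable (toConfig (d := d) n) :=
  measurable_iff_le_map.2 fun _ hs => (MeasurableSpace.measurableSet_iInf.1 hs) n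

theorem measurableSet_config_iff {d : ℕ} (A : Set (Config d)) :
    MeasurableSet A ↔ ∀ n, MeasurableSet (toConfig n ⁻¹' A) :=
  MeasurableSpace.measurableSet_iInf

/-- The rectangular box `∏ᵢ (lowerᵢ, upperᵢ]` as a subset of `ℝ^d`. -/
def region {d : ℕ} (Λ : BoxIntegral.Box (Fin d)) : Set (Point d) :=
  {x | WithLp.ofLp x ∈ Λ}

/-- `|x - y| ≤ 1` with the difference understood modulo the box `Λ` (periodic boundary
conditions): some representative of `x - y` modulo the side lengths has norm at most `1`. -/
def Near {d : ℕ} (Λ : BoxIntegral.Box (Fin d)) (x y : Point d) : Prop :=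
  ∃ m : Fin d → ℤ,
    ‖x - y + WithLp.toLp 2 (fun i => (m i : ℝ) * (Λ.upper i - Λ.lower i))‖ ≤ 1

/-- The graph `(X, E_X)`: distinct points of `X` are joined iff `|x - y| ≤ 1` modulo `Λ`. -/
def graph {d : ℕ} (Λ : BoxIntegral.Box (Fin d)) (X : Finset (Point d)) : SimpleGraph X :=
  SimpleGraph.fromRel fun x y => Near Λ x.1 y.1

/-- `k(X)`, the number of clusters (connected components) of `(X, E_X)`. -/
def numClusters {d : ℕ} (Λ : BoxIntegral.Box (Fin d)) (X : Finset (Point d)) : ℕ :=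
  Nat.card (graph Λ X).ConnectedComponent

/-- `C` is a cluster of `X`, i.e. the vertex set of a connected component of `(X, E_X)`. -/
def IsCluster {d : ℕ} (Λ : BoxIntegral.Box (Fin d)) (X C : Finset (Point d)) : Prop :=
  ∃ c : (graph Λ X).ConnectedComponent, (C : Set (Point d)) = Subtype.val '' c.supp

/-- `κ(Λ)`, the maximal number of clusters of a configuration in `Λ`. -/
def maxClusters {d : ℕ} (Λ : BoxIntegral.Box (Fin d)) : ℕ :=
  sSup {k | ∃ X : Finset (Point d), (X : Set (Point d)) ⊆ region Λ ∧ numClusters Λ X = k}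

/-- The Lebesgue–Poisson measure
`L_Λ(A) = ∑ₙ 1/n! ∫_{Λⁿ} 1_A({x₁, …, xₙ}) dx₁ ⋯ dxₙ`. -/
def lebesguePoisson {d : ℕ} (Λ : BoxIntegral.Box (Fin d)) : Measure (Config d) :=
  Measure.sum fun n : ℕ =>
    (Nat.factorial n : ENNReal)⁻¹ •
      (Measure.pi fun _ : Fin n => (volume : Measure (Point d)).restrict (region Λ)).map
        (toConfig n)

/-- The weight `z^{#X} q^{k(X)}`. -/
def weight {d : ℕ} (Λ : BoxIntegral.Box (Fin d)) (q z : ℝ) (X : Config d) : ENNReal :=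
  ENNReal.ofReal (z ^ X.points.card * q ^ numClusters Λ X.points)

/-- The normalizing constant `Z_{Λ,z,0}`. -/
def partitionFunction {d : ℕ} (Λ : BoxIntegral.Box (Fin d)) (q z : ℝ) : ENNReal :=
  ∫⁻ X, weight Λ q z X ∂(lebesguePoisson Λ)

/-- The random-cluster measure `χ_{Λ,z,0}` of the Widom–Rowlinson model. At `T = 0` the
edge set of a configuration `X` is deterministic, so it is a measure on configurations. -/
def randomCluster {d : ℕ} (Λ : BoxIntegral.Box (Fin d)) (q z : ℝ) : Measure (Config d) :=
  (partitionFunction Λ q z)⁻¹ • (lebesguePoisson Λ).withDensity (weight Λ q z)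

/-- The part `𝒰(Y)` of `Λ` in which any point is connected to `Y`. -/
def covered {d : ℕ} (Λ : BoxIntegral.Box (Fin d)) (Y : Set (Point d)) : Set (Point d) :=
  {x | x ∈ region Λ ∧ ∃ y ∈ Y, Near Λ y x}

/-- The available free space `Δ_C(X) = Λ \ 𝒰(X \ C)` of `C`. -/
def freeSpace {d : ℕ} (Λ : BoxIntegral.Box (Fin d)) (X C : Finset (Point d)) : Set (Point d) :=
  region Λ \ covered Λ ((X : Set (Point d)) \ (C : Set (Point d)))

/-- `L_{Δ|N}`, the distribution of `N` particles thrown independently and uniformly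
into `Δ`. -/
def uniformConfig {d : ℕ} (Δ : Set (Point d)) (N : ℕ) : Measure (Config d) :=
  ((volume Δ) ^ N)⁻¹ •
    (Measure.pi fun _ : Fin N => (volume : Measure (Point d)).restrict Δ).map (toConfig N)

/-- The dissociation probability `δ_C(X) = L_{Δ_C(X)|#C}(ξ : k(ξ) ≥ 2)`. -/
def dissociationProb {d : ℕ} (Λ : BoxIntegral.Box (Fin d)) (X C : Finset (Point d)) : ℝ :=
  (uniformConfig (freeSpace Λ X C) C.card).real {ξ | 2 ≤ numClusters Λ ξ.points}

end ContinuumPotts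

end

/-!
Erasing a cluster `C` of `X` and throwing `#C` points anew into its free space `Δ_C(X)` leaves all
other clusters untouched, because the new points cannot join them. Conditionally on `X \ C`, the
weight of the new points is `q` to the number of clusters they form. For `q ≥ 1`, one cluster weighs
`q` and at least two weigh at least `q ^ 2`, so if `δ_C(X) ≥ δ` then the former case carries at most
`1 / (δ q)` of the total weight. Summing over `C` overcounts: after the resampling, `C` is a union
of clusters, and a configuration with `k` clusters has `2 ^ k` such unions, where `k ≤ κ(Λ)`. For
`q ≤ 1` the bound is at least `1` whenever the event is nonempty, because `δ_C(X) ≤ 1`.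
-/

noncomputable section

namespace ContinuumPotts

open Function Set
open scoped ENNReal NNReal

section Clusters

variable {ι κ α : Type*}

/-- The number of clusters of a family `x` of points, indices `i` and `j` being joined whenever
`r (x i) (x j)`. The clusters are the classes of the equivalence relation generated by the joins. -/
def clusterCount (r : α → α → Prop) (x : ι → α) : ℕ :=
  Nat.card (Quot (r on x))

/-- A set is isolated if no element outside it is related to an element of it. For a symmetric
relation the isolated sets are exactly the unions of clusters. -/
def IsIsolated (r : ι → ι → Prop) (S : Set ι) : Prop :=
  ∀ i ∈ S, ∀ j ∉ S, ¬ r j i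

section Isolated

variable {r : ι → ι → Prop} {S : Set ι}

theorem isIsolated_preimage_quotMk (T : Set (Quot r)) : IsIsolated r (Quot.mk r ⁻¹' T) :=
  fun _ hi _ hj hji => hj (by rwa [mem_preimage, Quot.sound hji])

variable [Std.Symm r]

theorem IsIsolated.mem_iff (h : IsIsolated r S) {i j : ι} (hij : r i j) : i ∈ S ↔ j ∈ S :=
  ⟨fun hi => by_contra fun hj => h i hi j hj (symm hij),
    fun hj => by_contra fun hi => h j hj i hi hij⟩

theorem IsIsolated.compl (h : IsIsolated r S) : IsIsolated r Sᶜ :=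
  fun _ hi _ hj hji => hi ((h.mem_iff hji).1 (not_not.1 hj))

theorem IsIsolated.preimage_image_quotMk (h : IsIsolated r S) :
    Quot.mk r ⁻¹' (Quot.mk r '' S) = S := by
  refine subset_antisymm (fun i ⟨j, hj, hji⟩ => ?_) (subset_preimage_image _ _)
  have hmem : Quot.lift (· ∈ S) (fun _ _ hab => propext (h.mem_iff hab)) (Quot.mk r i) := by
    rwa [← hji]
  exact hmem

theorem IsIsolated.injective_quotMap (h : IsIsolated r S) :
    Injective (Quot.map Subtype.val (fun _ _ hij => hij) : Quot (r on ((↑) : S → ι)) → Quot r) := by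
  classical
  let restrict : Quot r → Option (Quot (r on ((↑) : S → ι))) :=
    Quot.lift (fun i => if hi : i ∈ S then some (Quot.mk _ ⟨i, hi⟩) else none) fun i j hij => by
      by_cases hi : i ∈ S
      · have hj := (h.mem_iff hij).1 hi
        rw [dif_pos hi, dif_pos hj]
        exact congrArg some (Quot.sound hij)
      · have hj := mt (h.mem_iff hij).2 hi
        rw [dif_neg hi, dif_neg hj]
  have hleft : restrict ∘ Quot.map Subtype.val (fun _ _ hij => hij) = some := by
    ext1 ⟨i⟩
    exact dif_pos i.2
  exact Injective.of_comp (f := restrict) (hleft ▸ Option.some_injective _)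

theorem IsIsolated.card_quot (h : IsIsolated r S) :
    Nat.card (Quot (r on ((↑) : S → ι))) = (Quot.mk r '' S).ncard := by
  rw [← ncard_univ, ← ncard_image_of_injective _ h.injective_quotMap, image_univ]
  congr 1
  ext c
  constructor
  · rintro ⟨⟨i⟩, rfl⟩
    exact ⟨i, i.2, rfl⟩
  · rintro ⟨i, hi, rfl⟩
    exact ⟨Quot.mk _ ⟨i, hi⟩, rfl⟩

theorem IsIsolated.card_quot_add_compl [Finite ι] (h : IsIsolated r S) :
    Nat.card (Quot (r on ((↑) : S → ι))) + Nat.card (Quot (r on ((↑) : ↥Sᶜ → ι))) =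
      Nat.card (Quot r) := by
  have himage : Quot.mk r '' Sᶜ = (Quot.mk r '' S)ᶜ := by
    rw [← (Quot.mk_surjective).image_preimage (Quot.mk r '' S)ᶜ, preimage_compl,
      h.preimage_image_quotMk]
  rw [h.card_quot, h.compl.card_quot, himage, ncard_add_ncard_compl]

theorem isIsolated_and_card_quot_eq_one_iff :
    IsIsolated r S ∧ Nat.card (Quot (r on ((↑) : S → ι))) = 1 ↔
      ∃ c : Quot r, S = Quot.mk r ⁻¹' {c} := by
  constructor
  · rintro ⟨h, hcard⟩
    obtain ⟨c, hc⟩ := ncard_eq_one.1 (h.card_quot.symm.trans hcard)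
    exact ⟨c, by rw [← hc, h.preimage_image_quotMk]⟩
  · rintro ⟨c, rfl⟩
    refine ⟨isIsolated_preimage_quotMk _, ?_⟩
    rw [(isIsolated_preimage_quotMk _).card_quot, Quot.mk_surjective.image_preimage,
      ncard_singleton]

variable (r) in
theorem ncard_isIsolated_le [Finite ι] : {S | IsIsolated r S}.ncard ≤ 2 ^ Nat.card (Quot r) := by
  have hmaps : {S | IsIsolated r S} ⊆ (Quot.mk r ⁻¹' ·) '' (univ : Set (Set (Quot r))) :=
    fun S hS => ⟨Quot.mk r '' S, mem_univ _, hS.preimage_image_quotMk⟩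
  calc {S | IsIsolated r S}.ncard ≤ (univ : Set (Set (Quot r))).ncard :=
        (ncard_le_ncard hmaps).trans (ncard_image_le (toFinite _))
    _ = 2 ^ Nat.card (Quot r) := by rw [← powerset_univ, ncard_powerset, ncard_univ]

end Isolated

/-- Reindexing along a surjection does not change the clusters of a reflexive relation. -/
def quotCompEquiv (r : α → α → Prop) [Std.Refl r] (x : ι → α) (f : κ → ι) (hf : Surjective f) :
    Quot (r on (x ∘ f)) ≃ Quot (r on x) where
  toFun := Quot.map f fun _ _ h => h
  invFun := Quot.map (surjInv hf) fun i j h => by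
    simpa only [onFun, comp_apply, surjInv_eq hf] using h
  left_inv := by
    rintro ⟨k⟩
    refine Quot.sound ?_
    simpa only [onFun, comp_apply, surjInv_eq hf] using refl (x (f k))
  right_inv := by
    rintro ⟨i⟩
    exact congrArg (Quot.mk _) (surjInv_eq hf i)

theorem clusterCount_comp_of_surjective (r : α → α → Prop) [Std.Refl r] (x : ι → α) {f : κ → ι}
    (hf : Surjective f) : clusterCount r (x ∘ f) = clusterCount r x :=
  Nat.card_congr (quotCompEquiv r x f hf)

/-- The connected components of `SimpleGraph.fromRel r` are the classes generated by `r`. -/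
def componentEquivQuot (r : α → α → Prop) :
    (SimpleGraph.fromRel r).ConnectedComponent ≃ Quot r where
  toFun := Quot.lift (Quot.mk r) fun a b h => by
    rw [SimpleGraph.reachable_iff_reflTransGen] at h
    induction h with
    | refl => rfl
    | tail _ hab ih =>
      obtain ⟨-, h | h⟩ := (SimpleGraph.fromRel_adj _ _ _).1 hab
      · exact ih.trans (Quot.sound h)
      · exact ih.trans (Quot.sound h).symm
  invFun := Quot.lift (SimpleGraph.fromRel r).connectedComponentMk fun a b h => by
    obtain rfl | hab := eq_or_ne a b
    · rfl
    · exact SimpleGraph.ConnectedComponent.sound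
        (SimpleGraph.Adj.reachable ((SimpleGraph.fromRel_adj _ _ _).2 ⟨hab, Or.inl h⟩))
  left_inv := by rintro ⟨a⟩; rfl
  right_inv := by rintro ⟨a⟩; rfl

/-- The set of values of a finite family of points. -/
def tupleSet [Finite ι] (x : ι → α) : Finset α :=
  (finite_range x).toFinset

@[simp]
theorem coe_tupleSet [Finite ι] (x : ι → α) : (tupleSet x : Set α) = range x :=
  (finite_range x).coe_toFinset

@[simp]
theorem mem_tupleSet [Finite ι] {x : ι → α} {a : α} : a ∈ tupleSet x ↔ ∃ i, x i = a := by
  simp [tupleSet]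

theorem surjective_codRestrict_tupleSet [Finite ι] (x : ι → α) :
    Surjective fun i => (⟨x i, mem_tupleSet.2 ⟨i, rfl⟩⟩ : tupleSet x) := by
  rintro ⟨a, ha⟩
  obtain ⟨i, rfl⟩ := mem_tupleSet.1 ha
  exact ⟨i, rfl⟩

theorem card_tupleSet_of_injective [Finite ι] {x : ι → α} (hx : Injective x) :
    (tupleSet x).card = Nat.card ι := by
  rw [← ncard_coe_finset, coe_tupleSet, ← image_univ, ncard_image_of_injective _ hx, ncard_univ]

theorem card_tupleSet_le [Finite ι] (x : ι → α) : (tupleSet x).card ≤ Nat.card ι := by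
  rw [← ncard_coe_finset, coe_tupleSet, ← image_univ, ← ncard_univ]
  exact ncard_image_le (toFinite _)

theorem card_tupleSet [Finite ι] (x : ι → α) : (tupleSet x).card = clusterCount (· = ·) x := by
  have hclass : Quot (Eq on ((↑) : tupleSet x → α)) ≃ tupleSet x :=
    { toFun := Quot.lift id fun _ _ h => Subtype.ext h
      invFun := Quot.mk _
      left_inv := by rintro ⟨a⟩; rfl
      right_inv := fun _ => rfl }
  calc (tupleSet x).card = clusterCount Eq ((↑) : tupleSet x → α) := by
        rw [clusterCount, Nat.card_congr hclass, Nat.card_eq_fintype_card, Fintype.card_coe]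
    _ = clusterCount Eq x :=
        (clusterCount_comp_of_surjective Eq _ (surjective_codRestrict_tupleSet x)).symm

theorem exists_clusterCount_le_of_totallyBounded {E : Type*} [PseudoMetricSpace E]
    {r : E → E → Prop} {ε : ℝ} (hε : 0 < ε) (hr : ∀ a b, dist a b ≤ ε → r a b) {B : Set E}
    (hB : TotallyBounded B) :
    ∃ N, ∀ A ⊆ B, clusterCount r ((↑) : A → E) ≤ N := by
  obtain ⟨t, ht, hcover⟩ := Metric.totallyBounded_iff.1 hB (ε / 2) (half_pos hε)
  have := ht.to_subtype
  refine ⟨Nat.card t, fun A hA => ?_⟩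
  have hcenter : ∀ a : A, ∃ y : t, (a : E) ∈ Metric.ball (y : E) (ε / 2) := fun a => by
    obtain ⟨y, hy, hay⟩ := mem_iUnion₂.1 (hcover (hA a.2))
    exact ⟨⟨y, hy⟩, hay⟩
  choose center hcenter using hcenter
  refine Nat.card_le_card_of_injective (fun c => center c.out) fun c c' h => ?_
  rw [← Quot.out_eq c, ← Quot.out_eq c']
  refine Quot.sound (hr _ _ ?_)
  have hc := Metric.mem_ball.1 (hcenter c.out)
  have hc' := Metric.mem_ball.1 (hcenter c'.out)
  rw [← show center c.out = center c'.out from h] at hc'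
  linarith [dist_triangle_right (c.out : E) c'.out (center c.out)]

end Clusters

section Resampling

theorem mul_setLIntegral_eq_one_le {Ω : Type*} [MeasurableSpace Ω] (ν : Measure Ω) {k : Ω → ℕ}
    (hk : Measurable k) {Q δ : ℝ≥0∞} (hQ : 1 ≤ Q) (hδ : δ ≤ (ν univ)⁻¹ * ν {ω | 2 ≤ k ω}) :
    Q * (δ * ∫⁻ ω in {ω | k ω = 1}, Q ^ k ω ∂ν) ≤ ∫⁻ ω, Q ^ k ω ∂ν := by
  have hone : ∫⁻ ω in {ω | k ω = 1}, Q ^ k ω ∂ν = Q * ν {ω | k ω = 1} := by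
    rw [← setLIntegral_const]
    exact setLIntegral_congr_fun (hk (measurableSet_singleton 1)) fun ω (hω : k ω = 1) => by
      simp only [hω, pow_one]
  have hsplit : δ * ν {ω | k ω = 1} ≤ ν {ω | 2 ≤ k ω} :=
    calc δ * ν {ω | k ω = 1} ≤ (ν univ)⁻¹ * ν {ω | 2 ≤ k ω} * ν univ := by gcongr; simp
      _ = (ν univ)⁻¹ * ν univ * ν {ω | 2 ≤ k ω} := by ring
      _ ≤ ν {ω | 2 ≤ k ω} := mul_le_of_le_one_left' (ENNReal.inv_mul_le_one _)
  calc Q * (δ * ∫⁻ ω in {ω | k ω = 1}, Q ^ k ω ∂ν) = Q ^ 2 * (δ * ν {ω | k ω = 1}) := by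
        rw [hone]
        ring
    _ ≤ Q ^ 2 * ν {ω | 2 ≤ k ω} := by gcongr
    _ = ∫⁻ _ in {ω | 2 ≤ k ω}, Q ^ 2 ∂ν := (setLIntegral_const _ _).symm
    _ ≤ ∫⁻ ω in {ω | 2 ≤ k ω}, Q ^ k ω ∂ν :=
        setLIntegral_mono' (hk measurableSet_Ici) fun ω hω => pow_le_pow_right₀ hQ hω
    _ ≤ ∫⁻ ω, Q ^ k ω ∂ν := setLIntegral_le_lintegral _ _

variable {E ι κ : Type*}

/-- The set of points that are joined to no member of the family `y`. -/
def freeSet (r : E → E → Prop) (y : κ → E) : Set E :=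
  {a | ∀ j, ¬ r (y j) a}

theorem isIsolated_on_iff {r : E → E → Prop} {x : ι → E} {S : Set ι} :
    IsIsolated (r on x) S ↔ ∀ i : S, x i ∈ freeSet r (Sᶜ.domRestrict x) :=
  ⟨fun h i j => h i i.2 j j.2, fun h i hi j hj => h ⟨i, hi⟩ ⟨j, hj⟩⟩

theorem IsIsolated.clusterCount_eq_add [Finite ι] {r : E → E → Prop} [Std.Symm r] {x : ι → E}
    {S : Set ι} (h : IsIsolated (r on x) S) :
    clusterCount r x = clusterCount r (S.domRestrict x) + clusterCount r (Sᶜ.domRestrict x) :=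
  h.card_quot_add_compl.symm

variable [MeasurableSpace E]

/-- The probability that `N` points thrown independently and uniformly into `A` form at least two
clusters. It is zero if `A` is a null set or has infinite measure, unless `N = 0`. -/
def splitProb (μ : Measure E) (r : E → E → Prop) (A : Set E) (N : ℕ) : ℝ≥0∞ :=
  (μ A ^ N)⁻¹ * (Measure.pi fun _ : Fin N => μ.restrict A) {u | 2 ≤ clusterCount r u}

variable {r : E → E → Prop} {μ : Measure E}

theorem measurable_clusterCount [Finite ι] (hr : Measurable (uncurry r)) :
    Measurable fun x : ι → E => clusterCount r x := by
  have hon : Measurable fun x : ι → E => (r on x) := by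
    unfold onFun
    fun_prop
  exact (Measurable.of_discrete (f := fun s : ι → ι → Prop => Nat.card (Quot s))).comp hon

theorem measurableSet_two_le_clusterCount [Finite ι] (hr : Measurable (uncurry r)) :
    MeasurableSet {x : ι → E | 2 ≤ clusterCount r x} :=
  measurable_clusterCount hr measurableSet_Ici

theorem measurable_pow_clusterCount [Finite ι] (hr : Measurable (uncurry r)) (Q : ℝ≥0∞) :
    Measurable fun x : ι → E => Q ^ clusterCount r x :=
  (Measurable.of_discrete (f := fun k : ℕ => Q ^ k)).comp (measurable_clusterCount hr)

theorem measurable_mem_freeSet [Countable κ] (hr : Measurable (uncurry r)) :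
    Measurable fun p : (κ → E) × E => p.2 ∈ freeSet r p.1 := by
  simp only [freeSet, mem_ofPred_eq]
  refine Measurable.forall fun j => ?_
  fun_prop

theorem measurable_forall_mem_freeSet [Countable ι] [Countable κ] (hr : Measurable (uncurry r)) :
    Measurable fun p : (κ → E) × (ι → E) => ∀ i, p.2 i ∈ freeSet r p.1 :=
  Measurable.forall fun i => (measurable_mem_freeSet hr).comp
    (measurable_fst.prodMk ((measurable_pi_apply i).comp measurable_snd))

theorem measurable_isIsolated [Countable ι] (hr : Measurable (uncurry r)) (S : Set ι) :
    Measurable fun x : ι → E => IsIsolated (r on x) S := by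
  simp only [isIsolated_on_iff]
  have hrestrict : Measurable fun x : ι → E => (Sᶜ.domRestrict x, S.domRestrict x) := by fun_prop
  exact (measurable_forall_mem_freeSet hr).comp hrestrict

variable [SigmaFinite μ]

theorem splitProb_card [Fintype ι] [Std.Refl r] (A : Set E) (hr : Measurable (uncurry r)) :
    splitProb μ r A (Fintype.card ι) =
      ((Measure.pi fun _ : ι => μ.restrict A) univ)⁻¹ *
        (Measure.pi fun _ : ι => μ.restrict A) {u | 2 ≤ clusterCount r u} := by
  have hmp := measurePreserving_piCongrLeft (fun _ : ι => μ.restrict A) (Fintype.equivFin ι).symm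
  rw [splitProb, ← hmp.measure_preimage (measurableSet_two_le_clusterCount hr).nullMeasurableSet]
  simp only [Measure.pi_univ, Measure.restrict_apply_univ, Finset.prod_const, Finset.card_univ]
  congr 2
  ext u
  have hu : MeasurableEquiv.piCongrLeft (fun _ : ι => E) (Fintype.equivFin ι).symm u =
      u ∘ Fintype.equivFin ι := by
    ext i
    simp [MeasurableEquiv.coe_piCongrLeft, Equiv.piCongrLeft_apply]
  simp only [mem_preimage, mem_ofPred_eq, hu,
    clusterCount_comp_of_surjective r u (Fintype.equivFin ι).surjective]

theorem measurable_splitProb_freeSet [Countable κ] (hr : Measurable (uncurry r)) {Ω : Type*}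
    [MeasurableSpace Ω] {y : Ω → κ → E} (hy : Measurable y) {N : Ω → ℕ} (hN : Measurable N) :
    Measurable fun ω => splitProb μ r (freeSet r (y ω)) (N ω) := by
  suffices h : Measurable fun p : ℕ × (κ → E) => splitProb μ r (freeSet r p.2) p.1 by
    have hpair : Measurable fun ω => (N ω, y ω) := hN.prodMk hy
    have hcomp := h.comp hpair
    exact hcomp
  refine measurable_from_prod_countable_right fun N => ?_
  have hsplit : Measurable fun p : (κ → E) × (Fin N → E) =>
      2 ≤ clusterCount r p.2 ∧ ∀ i, p.2 i ∈ freeSet r p.1 :=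
    (measurableSet_setOfPred.1 (measurable_snd (measurableSet_two_le_clusterCount hr))).and
      (measurable_forall_mem_freeSet hr)
  have hnum : ∀ y : κ → E, (Measure.pi fun _ : Fin N => μ.restrict (freeSet r y))
      {u | 2 ≤ clusterCount r u} = (Measure.pi fun _ : Fin N => μ)
        (Prod.mk y ⁻¹' {p | 2 ≤ clusterCount r p.2 ∧ ∀ i, p.2 i ∈ freeSet r p.1}) := fun y => by
    rw [← Measure.restrict_pi_pi, Measure.restrict_apply (measurableSet_two_le_clusterCount hr)]
    congr 1
    ext u
    simp only [mem_inter_iff, mem_univ_pi, mem_preimage, mem_ofPred_eq]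
  simp only [splitProb, hnum]
  exact ((measurable_measure_prodMk_left
    (measurableSet_setOfPred.2 (measurable_mem_freeSet hr))).pow_const N).inv.mul
    (measurable_measure_prodMk_left (measurableSet_setOfPred.2 hsplit))

theorem measurePreserving_domRestrict [Fintype ι] (S : Set ι) [hS : Fintype S]
    [hSc : Fintype ↥Sᶜ] :
    MeasurePreserving (fun x : ι → E => (S.domRestrict x, Sᶜ.domRestrict x))
      (Measure.pi fun _ => μ) ((Measure.pi fun _ => μ).prod (Measure.pi fun _ => μ)) := by
  classical
  obtain rfl : hS = Subtype.fintype (· ∈ S) := Subsingleton.elim _ _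
  obtain rfl : hSc = Subtype.fintype (· ∉ S) := Subsingleton.elim _ _
  exact measurePreserving_piEquivPiSubtypeProd (fun _ : ι => μ) (· ∈ S)

theorem ae_injective_pi [Fintype ι] [MeasurableEq E] [NullSingletonClass μ] :
    ∀ᵐ x ∂(Measure.pi fun _ : ι => μ), Injective x := by
  classical
  have hne (i j : ι) (hij : i ≠ j) : ∀ᵐ x ∂(Measure.pi fun _ : ι => μ), x i ≠ x j := by
    let diag : Set ((↥({i} : Set ι) → E) × (↥({i} : Set ι)ᶜ → E)) :=
      {p | p.1 ⟨i, rfl⟩ = p.2 ⟨j, hij.symm⟩}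
    have hdiag : MeasurableSet diag := measurableSet_eq_fun (by fun_prop) (by fun_prop)
    have hnull : (Measure.pi fun _ => μ).prod (Measure.pi fun _ => μ) diag = 0 := by
      refine (Measure.measure_prod_null hdiag).2 (ae_of_all _ fun u => ?_)
      simp only [diag, preimage_ofPred_eq, eq_comm (a := u _)]
      exact Measure.pi_hyperplane (fun _ => μ) _ _
    simpa only [ae_iff, not_not] using!
      ((measurePreserving_domRestrict {i}).measure_preimage hdiag.nullMeasurableSet).trans hnull
  filter_upwards [ae_all_iff.2 fun i => ae_all_iff.2 fun j => ae_all_iff.2 (hne i j)] with x hx i j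
  exact not_imp_not.1 (hx i j)

theorem setLIntegral_isIsolated [Fintype ι] (hr : Measurable (uncurry r))
    (S : Set ι) [Fintype S] [Fintype ↥Sᶜ] {f : (S → E) × (↥Sᶜ → E) → ℝ≥0∞} (hf : Measurable f) :
    ∫⁻ x in {x | IsIsolated (r on x) S}, f (S.domRestrict x, Sᶜ.domRestrict x)
        ∂(Measure.pi fun _ => μ) =
      ∫⁻ y, ∫⁻ u, f (u, y) ∂(Measure.pi fun _ => μ.restrict (freeSet r y))
        ∂(Measure.pi fun _ => μ) := by
  let free : Set ((S → E) × (↥Sᶜ → E)) := {p | ∀ i, p.1 i ∈ freeSet r p.2}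
  have hfree : MeasurableSet free :=
    measurableSet_setOfPred.2 ((measurable_forall_mem_freeSet hr).comp measurable_swap)
  have hfiber (y : ↥Sᶜ → E) : (fun u => (u, y)) ⁻¹' free = univ.pi fun _ => freeSet r y := by
    ext u
    simp only [free, mem_preimage, mem_ofPred_eq, mem_univ_pi]
  calc ∫⁻ x in {x | IsIsolated (r on x) S}, f (S.domRestrict x, Sᶜ.domRestrict x)
          ∂(Measure.pi fun _ => μ)
      = ∫⁻ x, free.indicator f (S.domRestrict x, Sᶜ.domRestrict x) ∂(Measure.pi fun _ => μ) := by
        rw [← lintegral_indicator (measurableSet_setOfPred.2 (measurable_isIsolated hr S))]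
        simp only [isIsolated_on_iff]
        rfl
    _ = ∫⁻ y, ∫⁻ u, free.indicator f (u, y) ∂(Measure.pi fun _ => μ) ∂(Measure.pi fun _ => μ) := by
        rw [(measurePreserving_domRestrict S).lintegral_comp (hf.indicator hfree),
          lintegral_prod_symm' _ (hf.indicator hfree)]
    _ = _ := by
        refine lintegral_congr fun y => ?_
        rw [← Measure.restrict_pi_pi, ← hfiber,
          ← lintegral_indicator (measurable_prodMk_right hfree)]
        rfl

/-- The members of `x` with index in `S` form a cluster, and `N` points thrown independently and
uniformly into the set of points that are not joined to the rest of `x` form at least two clusters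
with probability at least `δ`. -/
def IsFragile (μ : Measure E) (r : E → E → Prop) (δ : ℝ≥0∞) (N : ℕ) (x : ι → E) (S : Set ι) :
    Prop :=
  IsIsolated (r on x) S ∧ clusterCount r (S.domRestrict x) = 1 ∧
    δ ≤ splitProb μ r (freeSet r (Sᶜ.domRestrict x)) N

theorem measurable_isFragile [Finite ι] (hr : Measurable (uncurry r)) (δ : ℝ≥0∞)
    {N : (ι → E) → ℕ} (hN : Measurable N) (S : Set ι) :
    Measurable fun x : ι → E => IsFragile μ r δ (N x) x S := by
  have hsplit : Measurable fun x : ι → E => splitProb μ r (freeSet r (Sᶜ.domRestrict x)) (N x) :=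
    measurable_splitProb_freeSet hr (measurable_restrict Sᶜ) hN
  have hcount : Measurable fun x : ι → E => clusterCount r (S.domRestrict x) :=
    (measurable_clusterCount hr).comp (measurable_restrict S)
  have hone : MeasurableSet {x : ι → E | clusterCount r (S.domRestrict x) = 1} :=
    hcount (measurableSet_singleton 1)
  exact (measurable_isIsolated hr S).and ((measurableSet_setOfPred.1 hone).and
    (measurableSet_setOfPred.1 (measurableSet_le measurable_const hsplit)))

variable [Std.Symm r] {Q δ : ℝ≥0∞}

theorem setLIntegral_isIsolated_pow_clusterCount [Fintype ι] (hr : Measurable (uncurry r))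
    (S : Set ι) [Fintype S] [Fintype ↥Sᶜ] {A : Set (S → E)} {B : Set (↥Sᶜ → E)}
    (hA : MeasurableSet A) (hB : MeasurableSet B) :
    ∫⁻ x in {x : ι → E | IsIsolated (r on x) S ∧ S.domRestrict x ∈ A ∧ Sᶜ.domRestrict x ∈ B},
        Q ^ clusterCount r x ∂(Measure.pi fun _ => μ) =
      ∫⁻ y in B, (∫⁻ u in A, Q ^ clusterCount r u ∂(Measure.pi fun _ => μ.restrict (freeSet r y))) *
        Q ^ clusterCount r y ∂(Measure.pi fun _ => μ) := by
  let F : (S → E) × (↥Sᶜ → E) → ℝ≥0∞ := fun p =>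
    A.indicator (fun u => Q ^ clusterCount r u) p.1 *
      B.indicator (fun y => Q ^ clusterCount r y) p.2
  have hFA := (measurable_pow_clusterCount hr Q).indicator hA
  have hF : Measurable F := (hFA.comp measurable_fst).mul
    (((measurable_pow_clusterCount hr Q).indicator hB).comp measurable_snd)
  have hrestrict : MeasurableSet {x : ι → E | S.domRestrict x ∈ A ∧ Sᶜ.domRestrict x ∈ B} :=
    (measurable_restrict S hA).inter (measurable_restrict Sᶜ hB)
  calc _ = ∫⁻ x in {x : ι → E | IsIsolated (r on x) S},
          F (S.domRestrict x, Sᶜ.domRestrict x) ∂(Measure.pi fun _ => μ) := by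
        rw [ofPred_and, inter_comm, ← setLIntegral_indicator hrestrict]
        refine setLIntegral_congr_fun (measurableSet_setOfPred.2 (measurable_isIsolated hr S))
          fun x (hx : IsIsolated _ _) => ?_
        by_cases hxA : S.domRestrict x ∈ A <;> by_cases hxB : Sᶜ.domRestrict x ∈ B <;>
          simp [F, hxA, hxB, hx.clusterCount_eq_add, pow_add]
    _ = _ := setLIntegral_isIsolated hr S hF
    _ = _ := by
        rw [← lintegral_indicator hB]
        refine lintegral_congr fun y => ?_
        simp only [F]
        rw [lintegral_mul_const _ hFA, lintegral_indicator hA]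
        by_cases hy : y ∈ B <;> simp [hy]

variable [Std.Refl r]

theorem mul_setLIntegral_isFragile_le [Fintype ι] (hr : Measurable (uncurry r)) (hQ : 1 ≤ Q)
    (S : Set ι) :
    Q * (δ * ∫⁻ x in {x : ι → E | IsFragile μ r δ (Nat.card S) x S}, Q ^ clusterCount r x
        ∂(Measure.pi fun _ => μ)) ≤
      ∫⁻ x in {x : ι → E | IsIsolated (r on x) S}, Q ^ clusterCount r x
        ∂(Measure.pi fun _ => μ) := by
  classical
  have hone : MeasurableSet {u : S → E | clusterCount r u = 1} :=
    measurable_clusterCount hr (measurableSet_singleton 1)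
  have hsplit : MeasurableSet {y : ↥Sᶜ → E | δ ≤ splitProb μ r (freeSet r y) (Nat.card S)} :=
    measurableSet_le measurable_const (measurable_splitProb_freeSet hr measurable_id
      measurable_const)
  have hfragile := setLIntegral_isIsolated_pow_clusterCount (μ := μ) (Q := Q) hr S hone hsplit
  have hisolated := setLIntegral_isIsolated_pow_clusterCount (μ := μ) (Q := Q) hr S .univ .univ
  simp only [mem_univ, and_true, Measure.restrict_univ] at hisolated
  rw [hisolated]
  refine (congrArg (fun t => Q * (δ * t)) hfragile).trans_le ?_
  grw [lintegral_const_mul_le, lintegral_const_mul_le, ← setLIntegral_le_lintegral]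
  refine setLIntegral_mono' hsplit fun y (hy : δ ≤ _) => ?_
  rw [Nat.card_eq_fintype_card, splitProb_card _ hr] at hy
  rw [← mul_assoc δ, ← mul_assoc Q]
  gcongr
  exact mul_setLIntegral_eq_one_le _ (measurable_clusterCount hr) hQ hy

theorem mul_setLIntegral_exists_isFragile_le [Fintype ι] (hr : Measurable (uncurry r))
    (hQ : 1 ≤ Q) :
    Q * (δ * ∫⁻ x in {x : ι → E | ∃ S : Set ι, IsFragile μ r δ (Nat.card S) x S},
        Q ^ clusterCount r x ∂(Measure.pi fun _ => μ)) ≤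
      ∫⁻ x, 2 ^ clusterCount r x * Q ^ clusterCount r x ∂(Measure.pi fun _ : ι => μ) := by
  classical
  calc Q * (δ * ∫⁻ x in {x : ι → E | ∃ S : Set ι, IsFragile μ r δ (Nat.card S) x S},
          Q ^ clusterCount r x ∂(Measure.pi fun _ => μ))
      ≤ Q * (δ * ∑ S : Set ι, ∫⁻ x in {x : ι → E | IsFragile μ r δ (Nat.card S) x S},
          Q ^ clusterCount r x ∂(Measure.pi fun _ => μ)) := by
        rw [ofPred_exists, ← tsum_fintype (L := .unconditional _)]
        gcongr
        exact lintegral_iUnion_le _ _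
    _ ≤ ∑ S : Set ι, ∫⁻ x in {x : ι → E | IsIsolated (r on x) S}, Q ^ clusterCount r x
          ∂(Measure.pi fun _ => μ) := by
        simp only [Finset.mul_sum]
        exact Finset.sum_le_sum fun S _ => mul_setLIntegral_isFragile_le hr hQ S
    _ = ∫⁻ x, {S | IsIsolated (r on x) S}.ncard * Q ^ clusterCount r x
          ∂(Measure.pi fun _ : ι => μ) := by
        have hiso (S : Set ι) : MeasurableSet {x : ι → E | IsIsolated (r on x) S} :=
          measurableSet_setOfPred.2 (measurable_isIsolated hr S)
        simp only [← lintegral_indicator (hiso _)]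
        rw [← lintegral_finsetSum _ fun S _ =>
          (measurable_pow_clusterCount hr Q).indicator (hiso S)]
        refine lintegral_congr fun x => ?_
        simp only [indicator, mem_ofPred_eq, ← Finset.sum_filter, Finset.sum_const, nsmul_eq_mul,
          ncard_eq_toFinset_card', toFinset_ofPred]
    _ ≤ ∫⁻ x, 2 ^ clusterCount r x * Q ^ clusterCount r x ∂(Measure.pi fun _ : ι => μ) := by
        refine lintegral_mono fun x => ?_
        gcongr
        exact_mod_cast ncard_isIsolated_le (r on x)

end Resampling

section Box

variable {d : ℕ} (Λ : BoxIntegral.Box (Fin d)) {ι : Type*} [Finite ι]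

theorem near_of_dist_le {x y : Point d} (h : dist x y ≤ 1) : Near Λ x y := by
  have hzero : WithLp.toLp 2 (fun i => (((0 : Fin d → ℤ) i : ℤ) : ℝ) * (Λ.upper i - Λ.lower i)) =
      (0 : Point d) := by
    ext i
    simp
  exact ⟨0, by rwa [hzero, add_zero, ← dist_eq_norm]⟩

instance : Std.Refl (Near Λ) where
  refl x := near_of_dist_le Λ (by simp)

instance : Std.Symm (Near Λ) where
  symm x y := fun ⟨m, hm⟩ => by
    have hneg : y - x + WithLp.toLp 2 (fun i => (((-m) i : ℤ) : ℝ) * (Λ.upper i - Λ.lower i)) =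
        -(x - y + WithLp.toLp 2 (fun i => (m i : ℝ) * (Λ.upper i - Λ.lower i))) := by
      ext i
      simp only [Pi.neg_apply, Int.cast_neg, neg_mul, PiLp.add_apply, PiLp.sub_apply, neg_add_rev,
        neg_sub, PiLp.neg_apply]
      ring
    exact ⟨-m, by rwa [hneg, norm_neg]⟩

theorem numClusters_tupleSet (x : ι → Point d) :
    numClusters Λ (tupleSet x) = clusterCount (Near Λ) x :=
  (Nat.card_congr (componentEquivQuot _)).trans
    (clusterCount_comp_of_surjective (Near Λ) _ (surjective_codRestrict_tupleSet x)).symm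

theorem toConfig_points (n : ℕ) (x : Fin n → Point d) : (toConfig n x).points = tupleSet x := by
  ext a
  simp [toConfig]

theorem isCluster_tupleSet_iff_exists_class (x : ι → Point d) (C : Finset (Point d)) :
    IsCluster Λ (tupleSet x) C ↔
      ∃ c : Quot (Near Λ on x), C = tupleSet ((Quot.mk _ ⁻¹' {c} : Set ι).domRestrict x) := by
  let e : Quot (Near Λ on x) ≃ (graph Λ (tupleSet x)).ConnectedComponent :=
    (quotCompEquiv (Near Λ) ((↑) : tupleSet x → Point d) _
      (surjective_codRestrict_tupleSet x)).trans (componentEquivQuot _).symm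
  have himage (c) : Subtype.val '' (e c).supp = x '' (Quot.mk _ ⁻¹' {c}) := by
    ext a
    constructor
    · rintro ⟨b, hb, rfl⟩
      obtain ⟨i, rfl⟩ := surjective_codRestrict_tupleSet x b
      exact ⟨i, e.injective hb, rfl⟩
    · rintro ⟨i, hi, rfl⟩
      exact ⟨⟨x i, mem_tupleSet.2 ⟨i, rfl⟩⟩, congrArg e hi, rfl⟩
  simp only [IsCluster, ← e.exists_congr_right, himage, ← Finset.coe_inj, coe_tupleSet,
    range_domRestrict]

theorem isCluster_tupleSet_iff (x : ι → Point d) (C : Finset (Point d)) :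
    IsCluster Λ (tupleSet x) C ↔ ∃ S : Set ι, IsIsolated (Near Λ on x) S ∧
      clusterCount (Near Λ) (S.domRestrict x) = 1 ∧ C = tupleSet (S.domRestrict x) := by
  rw [isCluster_tupleSet_iff_exists_class]
  constructor
  · rintro ⟨c, rfl⟩
    obtain ⟨h, hcard⟩ := isIsolated_and_card_quot_eq_one_iff.2 ⟨c, rfl⟩
    exact ⟨_, h, hcard, rfl⟩
  · rintro ⟨S, h, hcard, rfl⟩
    obtain ⟨c, rfl⟩ := isIsolated_and_card_quot_eq_one_iff.1 ⟨h, hcard⟩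
    exact ⟨c, rfl⟩

theorem isBounded_region : Bornology.IsBounded (region Λ) := by
  have hIcc : Bornology.IsBounded (Icc Λ.lower Λ.upper) := Metric.isBounded_Icc _ _
  refine ((PiLp.lipschitzWith_toLp 2 fun _ : Fin d => ℝ).isBounded_image hIcc).subset ?_
  exact fun x hx => ⟨WithLp.ofLp x, BoxIntegral.Box.coe_subset_Icc hx, rfl⟩

theorem measurableSet_region : MeasurableSet (region Λ) :=
  Λ.measurableSet_coe.preimage (WithLp.measurable_ofLp 2 _)

theorem measurable_near : Measurable (uncurry (Near Λ)) := by
  refine measurableSet_setOfPred.1 ?_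
  simp only [uncurry_def, Near, ofPred_exists]
  exact MeasurableSet.iUnion fun m =>
    (isClosed_le (by fun_prop) continuous_const).measurableSet

theorem numClusters_eq_clusterCount (X : Finset (Point d)) :
    numClusters Λ X = clusterCount (Near Λ) ((↑) : X → Point d) :=
  Nat.card_congr (componentEquivQuot _)

theorem isGreatest_maxClusters :
    IsGreatest {k | ∃ X : Finset (Point d), (X : Set (Point d)) ⊆ region Λ ∧ numClusters Λ X = k}
      (maxClusters Λ) := by
  obtain ⟨N, hN⟩ := exists_clusterCount_le_of_totallyBounded one_pos
    (fun _ _ => near_of_dist_le Λ)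
    ((isBounded_region Λ).isCompact_closure.totallyBounded.subset subset_closure)
  have hbdd : BddAbove {k | ∃ X : Finset (Point d), (X : Set (Point d)) ⊆ region Λ ∧
      numClusters Λ X = k} := by
    refine ⟨N, ?_⟩
    rintro _ ⟨X, hX, rfl⟩
    exact (numClusters_eq_clusterCount Λ X).trans_le (hN X hX)
  exact ⟨Nat.sSup_mem ⟨_, ∅, by simp, rfl⟩ hbdd, fun _ hk => le_csSup hbdd hk⟩

theorem clusterCount_le_maxClusters {x : ι → Point d}
    (hx : ∀ i, x i ∈ region Λ) : clusterCount (Near Λ) x ≤ maxClusters Λ :=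
  (isGreatest_maxClusters Λ).2
    ⟨tupleSet x, by simpa [range_subset_iff] using hx, numClusters_tupleSet Λ x⟩

end Box

section RandomCluster

theorem tsum_inv_factorial_mul_pow_ne_top {a : ℝ≥0∞} (ha : a ≠ ⊤) :
    ∑' n : ℕ, (Nat.factorial n : ℝ≥0∞)⁻¹ * a ^ n ≠ ⊤ := by
  lift a to ℝ≥0 using ha
  have hterm (n : ℕ) : (Nat.factorial n : ℝ≥0∞)⁻¹ * (a : ℝ≥0∞) ^ n =
      ((a ^ n / Nat.factorial n : ℝ≥0) : ℝ≥0∞) := by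
    rw [ENNReal.coe_div (by positivity), ENNReal.div_eq_inv_mul]
    push_cast
    rfl
  simp only [hterm, ENNReal.tsum_coe_ne_top_iff_summable]
  exact_mod_cast Real.summable_pow_div_factorial a

variable {d : ℕ} (Λ : BoxIntegral.Box (Fin d))

/-- Lebesgue measure on the box `Λ`. -/
abbrev boxVolume : Measure (Point d) :=
  volume.restrict (region Λ)

instance : IsFiniteMeasure (boxVolume Λ) :=
  isFiniteMeasure_restrict.2 (isBounded_region Λ).measure_lt_top.ne

/-- The event that the configuration lies in `Λ` and has a cluster whose dissociation probability
is at least `δ`. -/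
def dissociationEvent (δ : ℝ) : Set (Config d) :=
  {X | (X.points : Set (Point d)) ⊆ region Λ ∧
    ∃ C : Finset (Point d), IsCluster Λ X.points C ∧ δ ≤ dissociationProb Λ X.points C}

theorem ae_mem_region (n : ℕ) :
    ∀ᵐ x ∂(Measure.pi fun _ : Fin n => boxVolume Λ), ∀ i, x i ∈ region Λ := by
  rw [ae_all_iff]
  exact fun i => (Measure.quasiMeasurePreserving_eval _ i).ae
    (ae_restrict_mem (measurableSet_region Λ))

theorem uniformConfig_le_one (Δ : Set (Point d)) (N : ℕ) (s : Set (Config d)) :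
    uniformConfig Δ N s ≤ 1 := by
  calc uniformConfig Δ N s ≤ uniformConfig Δ N univ := measure_mono (subset_univ s)
    _ = (volume Δ ^ N)⁻¹ * volume Δ ^ N := by
        simp only [uniformConfig, Measure.smul_apply, smul_eq_mul,
          Measure.map_apply (measurable_toConfig N) .univ, preimage_univ, Measure.pi_univ,
          Measure.restrict_apply_univ, Finset.prod_const, Finset.card_fin]
    _ ≤ 1 := ENNReal.inv_mul_le_one _

theorem dissociationProb_le_one (X C : Finset (Point d)) : dissociationProb Λ X C ≤ 1 :=
  ENNReal.toReal_le_of_le_ofReal zero_le_one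
    (ENNReal.ofReal_one.symm ▸ uniformConfig_le_one _ _ _)

theorem dissociationEvent_eq_empty_of_one_lt {δ : ℝ} (hδ : 1 < δ) : dissociationEvent Λ δ = ∅ :=
  eq_empty_of_forall_notMem fun X ⟨_, C, _, hC⟩ =>
    hδ.not_ge (hC.trans (dissociationProb_le_one Λ X.points C))

theorem dissociationEvent_eq_empty_of_subsingleton [Subsingleton (Point d)] {δ : ℝ} (hδ : 0 < δ) :
    dissociationEvent Λ δ = ∅ := by
  have hnone : {ξ : Config d | 2 ≤ numClusters Λ ξ.points} = ∅ :=
    eq_empty_of_forall_notMem fun ξ (hξ : 2 ≤ numClusters Λ ξ.points) => by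
      have hone : numClusters Λ ξ.points ≤ 1 := Finite.card_le_one_iff_subsingleton.2
        (SimpleGraph.Preconnected.of_subsingleton.subsingleton_connectedComponent)
      omega
  refine eq_empty_of_forall_notMem fun X ⟨_, C, _, hC⟩ => hδ.not_ge (hC.trans_eq ?_)
  rw [dissociationProb, hnone, measureReal_empty]

theorem measurableSet_two_le_numClusters :
    MeasurableSet {ξ : Config d | 2 ≤ numClusters Λ ξ.points} := by
  refine (measurableSet_config_iff _).2 fun n => ?_
  simp only [preimage_ofPred_eq, toConfig_points, numClusters_tupleSet]
  exact measurableSet_two_le_clusterCount (measurable_near Λ)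

theorem uniformConfig_two_le_numClusters (A : Set (Point d)) (N : ℕ) :
    uniformConfig (region Λ ∩ A) N {ξ | 2 ≤ numClusters Λ ξ.points} =
      splitProb (boxVolume Λ) (Near Λ) A N := by
  simp only [uniformConfig, splitProb, Measure.smul_apply, smul_eq_mul, inter_comm (region Λ),
    Measure.map_apply (measurable_toConfig N) (measurableSet_two_le_numClusters Λ),
    Measure.restrict_apply' (measurableSet_region Λ),
    Measure.restrict_restrict' (measurableSet_region Λ),
    preimage_ofPred_eq, toConfig_points, numClusters_tupleSet]

variable {ι : Type*} [Finite ι] {x : ι → Point d} {S : Set ι}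

theorem freeSpace_tupleSet (h : IsIsolated (Near Λ on x) S) :
    freeSpace Λ (tupleSet x) (tupleSet (S.domRestrict x)) =
      region Λ ∩ freeSet (Near Λ) (Sᶜ.domRestrict x) := by
  have hrest : range x \ x '' S = x '' Sᶜ := by
    refine subset_antisymm
      (fun _ ⟨⟨j, hj⟩, hjS⟩ => ⟨j, fun hS => hjS ⟨j, hS, hj⟩, hj⟩) ?_
    rintro _ ⟨j, hj, rfl⟩
    refine ⟨mem_range_self j, fun ⟨i, hi, hij⟩ => h i hi j hj ?_⟩
    simpa only [onFun, hij] using refl (x j)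
  ext a
  simp only [freeSpace, covered, freeSet, coe_tupleSet, range_domRestrict, hrest, mem_sdiff,
    mem_inter_iff, mem_ofPred_eq, exists_mem_image, not_and, not_exists, Subtype.forall,
    domRestrict_apply]
  tauto

theorem le_dissociationProb_tupleSet_iff {δ : ℝ} (h : IsIsolated (Near Λ on x) S) :
    δ ≤ dissociationProb Λ (tupleSet x) (tupleSet (S.domRestrict x)) ↔
      ENNReal.ofReal δ ≤ splitProb (boxVolume Λ) (Near Λ) (freeSet (Near Λ) (Sᶜ.domRestrict x))
        (tupleSet (S.domRestrict x)).card := by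
  rw [← uniformConfig_two_le_numClusters, ← freeSpace_tupleSet Λ h, dissociationProb,
    Measure.real, ENNReal.ofReal_le_iff_le_toReal]
  exact ne_top_of_le_ne_top ENNReal.one_ne_top (uniformConfig_le_one _ _ _)

theorem toConfig_mem_dissociationEvent_iff {n : ℕ} {x : Fin n → Point d} {δ : ℝ} :
    toConfig n x ∈ dissociationEvent Λ δ ↔ (∀ i, x i ∈ region Λ) ∧ ∃ S,
      IsFragile (boxVolume Λ) (Near Λ) (ENNReal.ofReal δ)
        (tupleSet (S.domRestrict x)).card x S := by
  simp only [dissociationEvent, mem_ofPred_eq, toConfig_points, coe_tupleSet, range_subset_iff,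
    isCluster_tupleSet_iff, IsFragile]
  refine and_congr_right fun _ => ⟨?_, ?_⟩
  · rintro ⟨_, ⟨S, hS, hone, rfl⟩, hδ⟩
    exact ⟨S, hS, hone, (le_dissociationProb_tupleSet_iff Λ hS).1 hδ⟩
  · rintro ⟨S, hS, hone, hδ⟩
    exact ⟨_, ⟨S, hS, hone, rfl⟩, (le_dissociationProb_tupleSet_iff Λ hS).2 hδ⟩

theorem measurable_card_tupleSet :
    Measurable fun x : ι → Point d => (tupleSet x).card := by
  simp only [card_tupleSet]
  exact measurable_clusterCount (measurable_fst.eq measurable_snd)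

theorem measurableSet_dissociationEvent (δ : ℝ) : MeasurableSet (dissociationEvent Λ δ) := by
  refine (measurableSet_config_iff _).2 fun n => measurableSet_setOfPred.2 ?_
  simp only [toConfig_mem_dissociationEvent_iff]
  refine Measurable.and ?_ (Measurable.exists fun S => measurable_isFragile (measurable_near Λ) _
    (measurable_card_tupleSet.comp (measurable_restrict S)) S)
  exact Measurable.forall fun i =>
    measurableSet_setOfPred.1 (measurable_pi_apply i (measurableSet_region Λ))

theorem setLIntegral_lebesguePoisson {A : Set (Config d)} (hA : MeasurableSet A)
    {f : Config d → ℝ≥0∞} (hf : Measurable f) :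
    ∫⁻ X in A, f X ∂(lebesguePoisson Λ) = ∑' n : ℕ, (Nat.factorial n : ℝ≥0∞)⁻¹ *
      ∫⁻ x in toConfig n ⁻¹' A, f (toConfig n x) ∂(Measure.pi fun _ => boxVolume Λ) := by
  simp only [lebesguePoisson, Measure.restrict_sum _ hA, lintegral_sum_measure,
    setLIntegral_smul_measure, setLIntegral_map hA hf (measurable_toConfig _), smul_eq_mul]

theorem measurable_weight (q z : ℝ) : Measurable (weight Λ q z) := fun s hs => by
  refine (measurableSet_config_iff _).2 fun n => ?_
  have hweight : Measurable fun x => weight Λ q z (toConfig n x) := by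
    simp only [weight, toConfig_points, numClusters_tupleSet]
    exact ((measurable_card_tupleSet.const_pow z).mul
      ((measurable_clusterCount (measurable_near Λ)).const_pow q)).ennreal_ofReal
  exact hweight hs

theorem partitionFunction_eq_tsum (q z : ℝ) :
    partitionFunction Λ q z = ∑' n : ℕ, (Nat.factorial n : ℝ≥0∞)⁻¹ *
      ∫⁻ x, weight Λ q z (toConfig n x) ∂(Measure.pi fun _ => boxVolume Λ) := by
  simpa only [partitionFunction, preimage_univ, Measure.restrict_univ] using
    setLIntegral_lebesguePoisson Λ .univ (measurable_weight Λ q z)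

theorem weight_toConfig {q z : ℝ} (hq : 0 ≤ q) (hz : 0 ≤ z) {n : ℕ} (x : Fin n → Point d) :
    weight Λ q z (toConfig n x) =
      ENNReal.ofReal z ^ (tupleSet x).card * ENNReal.ofReal q ^ clusterCount (Near Λ) x := by
  rw [weight, ENNReal.ofReal_mul (by positivity), ENNReal.ofReal_pow hz, ENNReal.ofReal_pow hq,
    toConfig_points, numClusters_tupleSet]

theorem partitionFunction_ne_zero (q z : ℝ) : partitionFunction Λ q z ≠ 0 := by
  rw [partitionFunction_eq_tsum]
  refine (lt_of_lt_of_le ?_ (ENNReal.le_tsum 0)).ne'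
  have hempty (x : Fin 0 → Point d) : weight Λ q z (toConfig 0 x) = 1 := by
    rw [weight, toConfig_points, numClusters_tupleSet]
    simp [clusterCount, tupleSet]
  simp [hempty]

theorem weight_toConfig_le {q z : ℝ} (hq : 0 ≤ q) (hz : 0 ≤ z) {n : ℕ} {x : Fin n → Point d}
    (hx : ∀ i, x i ∈ region Λ) :
    weight Λ q z (toConfig n x) ≤
      (1 + ENNReal.ofReal z) ^ n * (1 + ENNReal.ofReal q) ^ maxClusters Λ := by
  rw [weight_toConfig Λ hq hz]
  exact mul_le_mul'
    (pow_le_pow le_add_self le_self_add ((card_tupleSet_le x).trans_eq (Nat.card_fin n)))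
    (pow_le_pow le_add_self le_self_add (clusterCount_le_maxClusters Λ hx))

theorem partitionFunction_ne_top {q z : ℝ} (hq : 0 ≤ q) (hz : 0 ≤ z) :
    partitionFunction Λ q z ≠ ⊤ := by
  let c := (1 + ENNReal.ofReal z) * volume (region Λ)
  let K := (1 + ENNReal.ofReal q) ^ maxClusters Λ
  have hc : c ≠ ⊤ :=
    ENNReal.mul_ne_top (by finiteness) (isBounded_region Λ).measure_lt_top.ne
  have hterm (n : ℕ) : ∫⁻ x, weight Λ q z (toConfig n x) ∂(Measure.pi fun _ => boxVolume Λ) ≤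
      c ^ n * K :=
    calc _ ≤ ∫⁻ _, (1 + ENNReal.ofReal z) ^ n * K ∂(Measure.pi fun _ : Fin n => boxVolume Λ) := by
          refine lintegral_mono_ae ?_
          filter_upwards [ae_mem_region Λ n] with x hx using weight_toConfig_le Λ hq hz hx
      _ = (1 + ENNReal.ofReal z) ^ n * K * volume (region Λ) ^ n := by
          simp only [lintegral_const, Measure.pi_univ, Measure.restrict_apply_univ,
            Finset.prod_const, Finset.card_fin]
      _ = c ^ n * K := by rw [mul_pow, mul_right_comm]
  refine ne_top_of_le_ne_top ?_ ((partitionFunction_eq_tsum Λ q z).trans_le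
    (ENNReal.tsum_le_tsum fun n => mul_le_mul_right (hterm n) _))
  simp only [← mul_assoc, ENNReal.tsum_mul_right]
  exact ENNReal.mul_ne_top (tsum_inv_factorial_mul_pow_ne_top hc) (by finiteness)

theorem isProbabilityMeasure_randomCluster {q z : ℝ} (hq : 0 ≤ q) (hz : 0 ≤ z) :
    IsProbabilityMeasure (randomCluster Λ q z) := by
  refine ⟨?_⟩
  rw [randomCluster, Measure.smul_apply, withDensity_apply _ .univ, Measure.restrict_univ,
    smul_eq_mul]
  exact ENNReal.inv_mul_cancel (partitionFunction_ne_zero Λ q z)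
    (partitionFunction_ne_top Λ hq hz)

theorem preimage_dissociationEvent_ae_le [Nontrivial (Point d)] (δ : ℝ) (n : ℕ) :
    (toConfig n ⁻¹' dissociationEvent Λ δ : Set (Fin n → Point d))
      ≤ᵐ[Measure.pi fun _ => boxVolume Λ]
        {x | ∃ S : Set (Fin n),
          IsFragile (boxVolume Λ) (Near Λ) (ENNReal.ofReal δ) (Nat.card S) x S} := by
  filter_upwards [ae_injective_pi (μ := boxVolume Λ)] with x hx hmem
  obtain ⟨-, S, hS⟩ := (toConfig_mem_dissociationEvent_iff Λ).1 hmem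
  have hcard : (tupleSet (S.domRestrict x)).card = Nat.card S :=
    card_tupleSet_of_injective (hx.comp Subtype.val_injective)
  exact ⟨S, hcard ▸ hS⟩

theorem ae_weight_toConfig_eq [Nontrivial (Point d)] {q z : ℝ} (hq : 0 ≤ q) (hz : 0 ≤ z) (n : ℕ) :
    ∀ᵐ x ∂(Measure.pi fun _ : Fin n => boxVolume Λ), weight Λ q z (toConfig n x) =
      ENNReal.ofReal z ^ n * ENNReal.ofReal q ^ clusterCount (Near Λ) x := by
  filter_upwards [ae_injective_pi (μ := boxVolume Λ)] with x hx
  rw [weight_toConfig Λ hq hz, card_tupleSet_of_injective hx, Nat.card_fin]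

theorem mul_setLIntegral_dissociationEvent_le {q δ z : ℝ} (hq : 1 ≤ q) (hδ : 0 < δ) (hz : 0 ≤ z)
    (n : ℕ) :
    ENNReal.ofReal q * (ENNReal.ofReal δ * ∫⁻ x in toConfig n ⁻¹' dissociationEvent Λ δ,
        weight Λ q z (toConfig n x) ∂(Measure.pi fun _ => boxVolume Λ)) ≤
      2 ^ maxClusters Λ *
        ∫⁻ x, weight Λ q z (toConfig n x) ∂(Measure.pi fun _ => boxVolume Λ) := by
  rcases subsingleton_or_nontrivial (Point d) with _ | _
  · simp [dissociationEvent_eq_empty_of_subsingleton Λ hδ]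
  let π := Measure.pi fun _ : Fin n => boxVolume Λ
  let W (x : Fin n → Point d) := ENNReal.ofReal q ^ clusterCount (Near Λ) x
  have hweight := ae_weight_toConfig_eq Λ (zero_le_one.trans hq) hz n
  rw [lintegral_congr_ae (ae_restrict_of_ae hweight), lintegral_congr_ae hweight,
    lintegral_const_mul' _ _ (by finiteness), lintegral_const_mul' _ _ (by finiteness)]
  calc _ = ENNReal.ofReal z ^ n * (ENNReal.ofReal q * (ENNReal.ofReal δ *
          ∫⁻ x in toConfig n ⁻¹' dissociationEvent Λ δ, W x ∂π)) := by ring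
    _ ≤ ENNReal.ofReal z ^ n * (ENNReal.ofReal q * (ENNReal.ofReal δ *
          ∫⁻ x in {x | ∃ S : Set (Fin n),
            IsFragile (boxVolume Λ) (Near Λ) (ENNReal.ofReal δ) (Nat.card S) x S}, W x ∂π)) := by
        gcongr ENNReal.ofReal z ^ n * (ENNReal.ofReal q * (ENNReal.ofReal δ * ?_))
        exact lintegral_mono' (Measure.restrict_mono_ae (preimage_dissociationEvent_ae_le Λ δ n))
          le_rfl
    _ ≤ ENNReal.ofReal z ^ n * ∫⁻ x, 2 ^ clusterCount (Near Λ) x * W x ∂π := by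
        gcongr
        exact mul_setLIntegral_exists_isFragile_le (measurable_near Λ)
          (ENNReal.one_le_ofReal.2 hq)
    _ ≤ ENNReal.ofReal z ^ n * ∫⁻ x, 2 ^ maxClusters Λ * W x ∂π := by
        gcongr ENNReal.ofReal z ^ n * ?_
        refine lintegral_mono_ae ?_
        filter_upwards [ae_mem_region Λ n] with x hx
        grw [clusterCount_le_maxClusters Λ hx]
        exact one_le_two
    _ = _ := by
        rw [lintegral_const_mul' _ _ (by finiteness)]
        ring

theorem mul_randomCluster_dissociationEvent_le {q δ z : ℝ} (hq : 1 ≤ q) (hδ : 0 < δ)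
    (hz : 0 ≤ z) :
    ENNReal.ofReal q * (ENNReal.ofReal δ * randomCluster Λ q z (dissociationEvent Λ δ)) ≤
      2 ^ maxClusters Λ := by
  have hevent := measurableSet_dissociationEvent Λ δ
  have hunnormalized : ENNReal.ofReal q * (ENNReal.ofReal δ *
      ∫⁻ X in dissociationEvent Λ δ, weight Λ q z X ∂(lebesguePoisson Λ)) ≤
        2 ^ maxClusters Λ * partitionFunction Λ q z := by
    rw [setLIntegral_lebesguePoisson Λ hevent (measurable_weight Λ q z),
      partitionFunction_eq_tsum]
    simp only [← ENNReal.tsum_mul_left]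
    refine ENNReal.tsum_le_tsum fun n => ?_
    simpa only [mul_left_comm (Nat.factorial n : ℝ≥0∞)⁻¹] using
      mul_le_mul_right (mul_setLIntegral_dissociationEvent_le Λ hq hδ hz n)
        (Nat.factorial n : ℝ≥0∞)⁻¹
  rw [randomCluster, Measure.smul_apply, withDensity_apply _ hevent, smul_eq_mul]
  calc _ = (partitionFunction Λ q z)⁻¹ * (ENNReal.ofReal q * (ENNReal.ofReal δ *
          ∫⁻ X in dissociationEvent Λ δ, weight Λ q z X ∂(lebesguePoisson Λ))) := by ring
    _ ≤ (partitionFunction Λ q z)⁻¹ * (2 ^ maxClusters Λ * partitionFunction Λ q z) := by gcongr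
    _ = (partitionFunction Λ q z)⁻¹ * partitionFunction Λ q z * 2 ^ maxClusters Λ := by ring
    _ ≤ 2 ^ maxClusters Λ := mul_le_of_le_one_left' (ENNReal.inv_mul_le_one _)

theorem randomCluster_real_dissociationEvent_le_of_one_le {q δ z : ℝ} (hq : 1 ≤ q) (hδ : 0 < δ)
    (hz : 0 ≤ z) :
    (randomCluster Λ q z).real (dissociationEvent Λ δ) ≤ 2 ^ maxClusters Λ / (δ * q) := by
  have hq₀ : 0 < q := zero_lt_one.trans_le hq
  have h := ENNReal.toReal_mono (by finiteness) (mul_randomCluster_dissociationEvent_le Λ hq hδ hz)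
  rw [ENNReal.toReal_mul, ENNReal.toReal_mul, ENNReal.toReal_ofReal hq₀.le,
    ENNReal.toReal_ofReal hδ.le, ENNReal.toReal_pow, ENNReal.toReal_ofNat] at h
  rw [le_div_iff₀ (by positivity), Measure.real]
  linarith

theorem randomCluster_real_dissociationEvent_le_of_le_one {q δ z : ℝ} (hq₀ : 0 < q) (hq : q ≤ 1)
    (hδ : 0 < δ) (hz : 0 ≤ z) :
    (randomCluster Λ q z).real (dissociationEvent Λ δ) ≤ 2 ^ maxClusters Λ / (δ * q) := by
  have := isProbabilityMeasure_randomCluster Λ hq₀.le hz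
  rcases le_or_gt δ 1 with hδ₁ | hδ₁
  · refine measureReal_le_one.trans ((one_le_div (by positivity)).2 ?_)
    exact (mul_le_one₀ hδ₁ hq₀.le hq).trans (one_le_pow₀ one_le_two)
  · rw [dissociationEvent_eq_empty_of_one_lt Λ hδ₁, measureReal_empty]
    positivity

end RandomCluster

end ContinuumPotts

end

open ContinuumPotts in
theorem mainTheorem1_general {d : ℕ} (Λ : BoxIntegral.Box (Fin d)) :
    IsGreatest {k | ∃ X : Finset (Point d), (X : Set (Point d)) ⊆ region Λ ∧
        numClusters Λ X = k}
      (maxClusters Λ) ∧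
    ∀ q : ℝ, 0 < q → ∀ δ : ℝ, 0 < δ → ∀ z : ℝ, 0 ≤ z →
      IsProbabilityMeasure (randomCluster Λ q z) ∧
      (randomCluster Λ q z).real
          {X : Config d | (X.points : Set (Point d)) ⊆ region Λ ∧
            ∃ C : Finset (Point d), IsCluster Λ X.points C ∧
              δ ≤ dissociationProb Λ X.points C}
        ≤ 2 ^ maxClusters Λ / (δ * q) := by
  refine ⟨isGreatest_maxClusters Λ, fun q hq δ hδ z hz =>
    ⟨isProbabilityMeasure_randomCluster Λ hq.le hz, ?_⟩⟩
  rcases le_total 1 q with hq₁ | hq₁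
  · exact randomCluster_real_dissociationEvent_le_of_one_le Λ hq₁ hδ hz
  · exact randomCluster_real_dissociationEvent_le_of_le_one Λ hq hq₁ hδ hz

open ContinuumPotts in
/-- The first conjunct says that the maximum defining `κ(Λ)` is attained; that the
random-cluster measure is a probability measure is stated together with the bound. -/
theorem mainTheorem1 {d : ℕ} (hd : 2 ≤ d) (Λ : BoxIntegral.Box (Fin d)) :
    IsGreatest {k | ∃ X : Finset (Point d), (X : Set (Point d)) ⊆ region Λ ∧
        numClusters Λ X = k}
      (maxClusters Λ) ∧
    ∀ q : ℝ, 0 < q → ∀ δ : ℝ, 0 < δ → ∀ z : ℝ, 0 < z →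
      MeasureTheory.IsProbabilityMeasure (randomCluster Λ q z) ∧
      (randomCluster Λ q z).real
          {X : Config d | (X.points : Set (Point d)) ⊆ region Λ ∧
            ∃ C : Finset (Point d), IsCluster Λ X.points C ∧
              δ ≤ dissociationProb Λ X.points C}
        ≤ 2 ^ maxClusters Λ / (δ * q) := by
  exact (mainTheorem1_general Λ).imp_right fun h q hq δ hδ z hz => h q hq δ hδ z hz.le
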